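/- Let $\gamma>0$ and let $x_0,y_0\in\mathbb R$ with $x_0+y_0=\lambda$. Consider the continuous-time random walk $(X(t),Y(t))_{t\ge 0}$ in $\mathbb R^2$ with $(X(0),Y(0))=(x_0,y_0)$ and navigation matrix $$A=\begin{pmatrix}-\gamma&\gamma\\ \gamma&-\gamma\end{pmatrix},$$ defined as follows: from a current position $(x,y)$, given the past, the waiting time until the next renewal is exponential with rate $x+y$; independently of it, the renewal is of type 1 with probability $x/(x+y)$ and of type 2 with probability $y/(x+y)$; a renewal of type $i$ adds the $i$-th row of $A$ to the position, and between renewals the walk rests. The walk is called tenable if, whatever stochastic path is followed (that is, along every sequence of renewals whose types have positive rate $x$, respectively $y$, when they occur), it never visits the origin and both coordinates stay nonnegative. The walk is tenable if and only if $x_0/\gamma$ and $y_0/\gamma$ are nonnegative integers and $\lambda>0$. If it is tenable, then $\lambda/\gamma$ is a positive integer, almost surely $X(t)+Y(t)=\lambda$ for all $t\ge 0$, and: 1. For all $t\ge 0$ and $u\in\mathbb R$ the moment generating function $\eta(t,u)=\mathbb E[e^{uX(t)}]$ is finite and $$\eta(t,u)=\Bigl(\frac{1+e^{-2\gamma t+\gamma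 u}+e^{\gamma u}-e^{-2\gamma t}}{1-e^{-2\gamma t+\gamma u}+e^{\gamma u}+e^{-2\gamma t}}\Bigr)^{x_0/\gamma}\Bigl(\frac{1-e^{-2\gamma t+\gamma u}+e^{\gamma u}+e^{-2\gamma t}}{2}\Bigr)^{\lambda/\gamma}.$$ 2. For all $u\in\mathbb R$, $\lim_{t\to\infty}\eta(t,u)=\bigl(\frac{1+e^{\gamma u}}{2}\bigr)^{\lambda/\gamma}$. 3. As $t\to\infty$, $X(t)/\gamma$ converges in distribution to $\mathrm{Binomial}(\lambda/\gamma,1/2)$; given $\gamma$ and $\lambda$, this limit does not depend on the starting point. -/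

import Mathlib

open MeasureTheory ProbabilityTheory Filter Topology
open scoped NNReal

/-- Positions which the walk with navigation matrix `A` started at `x₀` can visit: from a
position `x`, a renewal of type `i` has positive rate iff `0 < x i`, and it adds row `i` of `A`. -/
inductive PolyaReachable {c : ℕ} (A : Matrix (Fin c) (Fin c) ℝ) (x₀ : Fin c → ℝ) :
    (Fin c → ℝ) → Prop
  | start : PolyaReachable A x₀ x₀
  | step {x : Fin c → ℝ} (i : Fin c) (hx : PolyaReachable A x₀ x) (hi : 0 < x i) :
      PolyaReachable A x₀ (x + A i)

/-- The walk is tenable: whatever stochastic path is followed, it avoids the origin and its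
coordinates stay nonnegative. -/
def PolyaTenable {c : ℕ} (A : Matrix (Fin c) (Fin c) ℝ) (x₀ : Fin c → ℝ) : Prop :=
  ∀ x, PolyaReachable A x₀ x → x ≠ 0 ∧ ∀ j, 0 ≤ x j

/-- The position after `n` renewals, when the `k`-th renewal (counted from `0`) has type `I k`. -/
def polyaPosition {Ω : Type*} {c : ℕ} (A : Matrix (Fin c) (Fin c) ℝ) (x₀ : Fin c → ℝ)
    (I : ℕ → Ω → Fin c) : ℕ → Ω → Fin c → ℝ
  | 0, _ => x₀
  | n + 1, ω => polyaPosition A x₀ I n ω + A (I n ω)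

/-- The time of the `n`-th renewal, when `T k` is the waiting time between the `k`-th and the
`(k+1)`-st renewal; `polyaRenewalTime T 0 = 0`. -/
noncomputable def polyaRenewalTime {Ω : Type*} (T : ℕ → Ω → ℝ) (n : ℕ) (ω : Ω) : ℝ :=
  ∑ k ∈ Finset.range n, T k ω

/-- The information on the first `n` renewals: the sigma-algebra generated by their waiting times
and their types. -/
@[reducible] def polyaHistory {Ω : Type*} {c : ℕ} (T : ℕ → Ω → ℝ) (I : ℕ → Ω → Fin c) (n : ℕ) :
    MeasurableSpace Ω :=
  MeasurableSpace.comap (fun ω (k : Fin n) => (T k ω, I k ω)) inferInstance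

/-- Waiting times `T` and renewal types `I` follow the dynamics of the continuum Pólya-like walk:
given the first `n` renewals, with current position `Z`, the next waiting time is exponential with
rate `∑ j, Z j`, and independently of it the type of the next renewal is `i` with probability
`Z i / ∑ j, Z j`. -/
structure IsPolyaClock {Ω : Type*} {mΩ : MeasurableSpace Ω} {c : ℕ}
    (A : Matrix (Fin c) (Fin c) ℝ) (x₀ : Fin c → ℝ) (P : Measure Ω)
    (T : ℕ → Ω → ℝ) (I : ℕ → Ω → Fin c) : Prop where
  measurable_time : ∀ n, Measurable (T n)
  measurable_type : ∀ n, Measurable (I n)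
  cond_law : ∀ (n : ℕ) (i : Fin c) (s : ℝ), 0 ≤ s →
    P⟦{ω | s < T n ω ∧ I n ω = i} | polyaHistory T I n⟧ =ᵐ[P] fun ω =>
      Real.exp (-(s * ∑ j, polyaPosition A x₀ I n ω j)) *
        (polyaPosition A x₀ I n ω i / ∑ j, polyaPosition A x₀ I n ω j)

/-- `X` is a continuum Pólya-like random walk with (deterministic) navigation matrix `A` and
starting point `x₀`: almost surely, between two consecutive renewals it rests at the position
which the renewals so far have produced. -/
def IsPolyaWalk {Ω : Type*} {mΩ : MeasurableSpace Ω} {c : ℕ}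
    (A : Matrix (Fin c) (Fin c) ℝ) (x₀ : Fin c → ℝ) (P : Measure Ω)
    (X : ℝ≥0 → Ω → Fin c → ℝ) : Prop :=
  ∃ (T : ℕ → Ω → ℝ) (I : ℕ → Ω → Fin c), IsPolyaClock A x₀ P T I ∧
    ∀ᵐ ω ∂P, ∀ (n : ℕ) (t : ℝ≥0),
      polyaRenewalTime T n ω ≤ t → (t : ℝ) < polyaRenewalTime T (n + 1) ω →
        X t ω = polyaPosition A x₀ I n ω

/-- The Ehrenfest navigation matrix. -/
def ehrenfestMatrix (γ : ℝ) : Matrix (Fin 2) (Fin 2) ℝ := !![-γ, γ; γ, -γ]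

/-! Tenability forces both coordinates to be multiples of `γ`, since otherwise repeated renewals of
one type push a coordinate below zero. The walk is then `γ (K, N - K)` with `K` the Ehrenfest count
of `N` particles, and the total rate is always `γ N`. Hence each waiting time is exponential with
that rate and independent of the past and of the accompanying type.

The embedded chain is diagonalised by the Krawtchouk polynomials, with eigenvalues `μ = 1 - 2j/N`
(`krawtchouk_recurrence`). For a bounded eigenfunction `f`, the contribution of the event "exactly
`n` renewals by time `t`" to `E f(K)` is `f(k₀)` times a Poisson weight times `μ ^ n`
(`setIntegral_ehrenfestCount`). Summing over `n` gives `exp (-2γjt) f(k₀)`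
(`IsPolyaWalk.integral_eigenfunction`).

Finally `z ^ k` expands in Krawtchouk polynomials (`sum_krawtchouk_mul_pow`), so `E z ^ K` is
explicit for real and complex `z`: `z = exp (γu)` gives the moment generating function, and `z = exp
(is)` the characteristic function, hence the limit law. -/

/-! ### Tenability and integrality of the starting point -/

lemma ehrenfestMatrix_apply_self (γ : ℝ) (i : Fin 2) : ehrenfestMatrix γ i i = -γ := by
  fin_cases i <;> simp [ehrenfestMatrix]

lemma PolyaReachable.add_nsmul {c : ℕ} {A : Matrix (Fin c) (Fin c) ℝ} {x : Fin c → ℝ} {i : Fin c}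
    (n : ℕ) (h : ∀ j < n, 0 < x i + j * A i i) : PolyaReachable A x (x + n • A i) := by
  induction n with
  | zero => simpa using PolyaReachable.start
  | succ n ih =>
    have := PolyaReachable.step i (ih fun j hj => h j (by omega)) (by simpa using h n (by omega))
    rwa [add_assoc, ← succ_nsmul] at this

lemma PolyaTenable.exists_div_eq_natCast {γ : ℝ} (hγ : 0 < γ) {x : Fin 2 → ℝ}
    (h : PolyaTenable (ehrenfestMatrix γ) x) (i : Fin 2) : ∃ k : ℕ, x i / γ = k := by
  have hx : 0 ≤ x i := (h x .start).2 i
  refine ⟨⌊x i / γ⌋₊, le_antisymm ?_ (Nat.floor_le (by positivity))⟩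
  by_contra! hlt
  have hlt' : (⌊x i / γ⌋₊ : ℝ) * γ < x i := by rwa [lt_div_iff₀ hγ] at hlt
  have hlt'' : x i < (⌊x i / γ⌋₊ + 1 : ℝ) * γ := by
    rw [← div_lt_iff₀ hγ]; exact Nat.lt_floor_add_one _
  -- If `x i / γ` is not an integer, the coordinate is still positive after `⌊x i / γ⌋₊` renewals of
  -- type `i`; one more makes it negative.
  have hr := PolyaReachable.add_nsmul (A := ehrenfestMatrix γ) (x := x) (i := i)
    (⌊x i / γ⌋₊ + 1) fun j hj => by
      have : (j : ℝ) ≤ ⌊x i / γ⌋₊ := by exact_mod_cast Nat.lt_succ_iff.mp hj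
      rw [ehrenfestMatrix_apply_self]
      nlinarith
  have := (h _ hr).2 i
  rw [Pi.add_apply, Pi.smul_apply, ehrenfestMatrix_apply_self, nsmul_eq_mul] at this
  push_cast at this
  linarith

lemma polyaReachable_ehrenfest {γ : ℝ} (hγ : 0 < γ) {k m : ℕ} {x : Fin 2 → ℝ}
    (h : PolyaReachable (ehrenfestMatrix γ) ![γ * k, γ * m] x) :
    ∃ a b : ℕ, a + b = k + m ∧ x = ![γ * a, γ * b] := by
  induction h with
  | start => exact ⟨k, m, rfl, rfl⟩
  | step i _ hi ih =>
    obtain ⟨a, b, hab, rfl⟩ := ih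
    fin_cases i
    · have ha : 0 < a := by
        have : 0 < γ * (a : ℝ) := by simpa using hi
        exact_mod_cast pos_of_mul_pos_right this hγ.le
      obtain ⟨a, rfl⟩ := Nat.exists_eq_succ_of_ne_zero ha.ne'
      refine ⟨a, b + 1, by omega, ?_⟩
      ext j; fin_cases j <;> simp [ehrenfestMatrix] <;> ring
    · have hb : 0 < b := by
        have : 0 < γ * (b : ℝ) := by simpa using hi
        exact_mod_cast pos_of_mul_pos_right this hγ.le
      obtain ⟨b, rfl⟩ := Nat.exists_eq_succ_of_ne_zero hb.ne'
      refine ⟨a + 1, b, by omega, ?_⟩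
      ext j; fin_cases j <;> simp [ehrenfestMatrix] <;> ring

lemma polyaTenable_ehrenfest_iff {γ : ℝ} (hγ : 0 < γ) {lam x₀ y₀ : ℝ} (hlam : x₀ + y₀ = lam) :
    PolyaTenable (ehrenfestMatrix γ) ![x₀, y₀] ↔
      (∃ k : ℕ, x₀ / γ = k) ∧ (∃ m : ℕ, y₀ / γ = m) ∧ 0 < lam := by
  constructor
  · intro h
    refine ⟨h.exists_div_eq_natCast hγ 0, h.exists_div_eq_natCast hγ 1, ?_⟩
    obtain ⟨h0, h1⟩ := h _ .start
    have hx : 0 ≤ x₀ := h1 0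
    have hy : 0 ≤ y₀ := h1 1
    by_contra! hl
    apply h0
    ext j; fin_cases j <;> simp <;> linarith
  · rintro ⟨⟨k, hk⟩, ⟨m, hm⟩, hl⟩ x hx
    rw [div_eq_iff hγ.ne', mul_comm] at hk hm
    subst hk hm
    obtain ⟨a, b, hab, rfl⟩ := polyaReachable_ehrenfest hγ hx
    refine ⟨fun h0 => ?_, fun j => ?_⟩
    · have ha : γ * (a : ℝ) = 0 := congrFun h0 0
      have hb : γ * (b : ℝ) = 0 := congrFun h0 1
      have : (a : ℝ) + b = k + m := by exact_mod_cast hab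
      nlinarith
    · fin_cases j <;> simp <;> positivity

/-! ### Krawtchouk polynomials -/

/-- The value at `k` of the Krawtchouk polynomial of degree `j`: the coefficient of `X ^ j` in
`(1 + X) ^ k * (1 - X) ^ (N - k)`. -/
noncomputable def krawtchouk (N j k : ℕ) : ℝ :=
  ((1 + Polynomial.X) ^ k * (1 - Polynomial.X) ^ (N - k) : Polynomial ℝ).coeff j

/-- This is the eigenvalue equation of the Ehrenfest chain. Truncated subtraction at `k = 0` and at
`k = N` is harmless, because the coefficient in front vanishes. -/
lemma krawtchouk_recurrence {N j k : ℕ} (hk : k ≤ N) :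
    k * krawtchouk N j (k - 1) + (N - k) * krawtchouk N j (k + 1) =
      (N - 2 * j) * krawtchouk N j k := by
  open Polynomial in
  obtain ⟨b, rfl⟩ := Nat.exists_eq_add_of_le hk
  -- Substitute `1 - X = (1 + X) - 2X` in the first term and `1 + X = (1 - X) + 2X` in the second;
  -- the `2X` parts assemble into the derivative.
  have key : (C (k : ℝ)) * ((1 + X) ^ (k - 1) * (1 - X) ^ (k + b - (k - 1))) +
      C (b : ℝ) * ((1 + X) ^ (k + 1) * (1 - X) ^ (k + b - (k + 1))) =
      C ((k : ℝ) + b) * ((1 + X) ^ k * (1 - X) ^ b) -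
        2 * (X * derivative ((1 + X) ^ k * (1 - X) ^ b)) := by
    rcases k with _ | k <;> rcases b with _ | b
    · simp
    · simp [derivative_pow]
      ring
    · simp [derivative_pow]
      ring
    · simp [derivative_pow, show (k + 1 + (b + 1) - k) = b + 2 by omega,
        show (k + 1 + (b + 1) - (k + 1 + 1)) = b by omega]
      ring
  have h2 := congrArg (fun p => p.coeff j) key
  simp only [coeff_add, coeff_sub, coeff_C_mul, coeff_ofNat_mul] at h2
  -- The Euler operator `X d/dX` acts on the coefficient of `X ^ j` as multiplication by `j`.
  have h3 : (X * derivative ((1 + X) ^ k * (1 - X) ^ b : ℝ[X])).coeff j =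
      j * ((1 + X) ^ k * (1 - X) ^ b : ℝ[X]).coeff j := by
    rcases j with _ | j
    · simp
    · rw [coeff_X_mul, coeff_derivative]; push_cast; ring
  rw [h3] at h2
  simp only [krawtchouk]
  rw [show k + b - k = b by omega]
  push_cast
  linarith

open Polynomial in
lemma natDegree_one_add_X_pow_mul_le (a b : ℕ) :
    ((1 + X) ^ a * (1 - X) ^ b : ℝ[X]).natDegree ≤ a + b := by
  compute_degree

open Polynomial in
-- Homogenisation in `(α, β)` is multiplicative: the factor `1 + εX` becomes `α + εβ` and the formal
-- degree rises by one.
lemma sum_coeff_mul_pow_one_add_X_mul {𝕜 : Type*} [RCLike 𝕜] (α β : 𝕜) (ε : ℝ) {n : ℕ} {p : ℝ[X]}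
    (hp : p.natDegree ≤ n) :
    ∑ j ∈ Finset.range (n + 2), ((((1 + C ε * X) * p).coeff j : ℝ) : 𝕜) * β ^ j * α ^ (n + 1 - j) =
      (α + ε * β) * ∑ j ∈ Finset.range (n + 1), ((p.coeff j : ℝ) : 𝕜) * β ^ j * α ^ (n - j) := by
  have h0 : p.coeff (n + 1) = 0 := coeff_eq_zero_of_natDegree_lt (by omega)
  have h1 : ∑ j ∈ Finset.range (n + 2), ((p.coeff j : ℝ) : 𝕜) * β ^ j * α ^ (n + 1 - j) =
      α * ∑ j ∈ Finset.range (n + 1), ((p.coeff j : ℝ) : 𝕜) * β ^ j * α ^ (n - j) := by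
    rw [Finset.sum_range_succ, h0, Finset.mul_sum]
    simp only [map_zero, zero_mul, add_zero]
    refine Finset.sum_congr rfl fun j hj => ?_
    have : n + 1 - j = (n - j) + 1 := by have := Finset.mem_range.mp hj; omega
    rw [this, pow_succ]; ring
  have h2 : ∑ j ∈ Finset.range (n + 2), (((X * p).coeff j : ℝ) : 𝕜) * β ^ j * α ^ (n + 1 - j) =
      β * ∑ j ∈ Finset.range (n + 1), ((p.coeff j : ℝ) : 𝕜) * β ^ j * α ^ (n - j) := by
    rw [Finset.sum_range_succ', Finset.mul_sum]
    simp only [coeff_X_mul, coeff_X_mul_zero, map_zero, zero_mul, add_zero]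
    refine Finset.sum_congr rfl fun j hj => ?_
    rw [show n + 1 - (j + 1) = n - j by omega, pow_succ]; ring
  rw [add_mul (α : 𝕜), ← h1, mul_assoc, ← h2, Finset.mul_sum, ← Finset.sum_add_distrib]
  refine Finset.sum_congr rfl fun j _ => ?_
  simp only [add_mul, one_mul, mul_assoc, coeff_add, coeff_C_mul, map_add, map_mul]

lemma sum_krawtchouk_mul_pow {𝕜 : Type*} [RCLike 𝕜] (α β : 𝕜) {N k : ℕ} (hk : k ≤ N) :
    ∑ j ∈ Finset.range (N + 1), (krawtchouk N j k : 𝕜) * β ^ j * α ^ (N - j) =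
      (α + β) ^ k * (α - β) ^ (N - k) := by
  open Polynomial in
  obtain ⟨b, rfl⟩ := Nat.exists_eq_add_of_le hk
  simp only [krawtchouk, Nat.add_sub_cancel_left]
  clear hk
  induction k with
  | zero =>
    induction b with
    | zero => simp
    | succ b ih =>
      have := sum_coeff_mul_pow_one_add_X_mul α β (-1) (natDegree_one_add_X_pow_mul_le 0 b)
      rw [ih] at this
      rw [show (1 + X) ^ 0 * (1 - X) ^ (b + 1) =
        (1 + C (-1) * X) * ((1 + X) ^ 0 * (1 - X) ^ b : ℝ[X]) by simp [pow_succ]; ring]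
      refine this.trans ?_
      simp only [RCLike.ofReal_neg, RCLike.ofReal_one]
      ring
  | succ k ih =>
    have := sum_coeff_mul_pow_one_add_X_mul α β 1 (natDegree_one_add_X_pow_mul_le k b)
    rw [ih] at this
    rw [show (1 + X) ^ (k + 1) * (1 - X) ^ b =
      (1 + C 1 * X) * ((1 + X) ^ k * (1 - X) ^ b : ℝ[X]) by simp [pow_succ]; ring,
      show k + 1 + b = k + b + 1 by ring]
    refine this.trans ?_
    simp only [RCLike.ofReal_one]
    ring

/-! ### Sigma-algebras of the past -/

section History

variable {Ω : Type*} {mΩ : MeasurableSpace Ω} {c : ℕ} {T : ℕ → Ω → ℝ} {I : ℕ → Ω → Fin c}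

/-- The information on the first `n` renewals together with the type of the next one. -/
@[reducible] def polyaHistoryType {Ω : Type*} {c : ℕ} (T : ℕ → Ω → ℝ) (I : ℕ → Ω → Fin c) (n : ℕ) :
    MeasurableSpace Ω :=
  MeasurableSpace.comap (fun ω => ((fun k : Fin n => (T k ω, I k ω)), I n ω)) inferInstance

lemma measurable_time_polyaHistory {n k : ℕ} (hk : k < n) : Measurable[polyaHistory T I n] (T k) :=
  (measurable_fst.comp (measurable_pi_apply (X := fun _ : Fin n => ℝ × Fin c) ⟨k, hk⟩)).comp
    (comap_measurable fun ω (k : Fin n) => (T k ω, I k ω))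

lemma measurable_type_polyaHistory {n k : ℕ} (hk : k < n) : Measurable[polyaHistory T I n] (I k) :=
  (measurable_snd.comp (measurable_pi_apply (X := fun _ : Fin n => ℝ × Fin c) ⟨k, hk⟩)).comp
    (comap_measurable fun ω (k : Fin n) => (T k ω, I k ω))

lemma polyaHistory_le_polyaHistoryType (n : ℕ) : polyaHistory T I n ≤ polyaHistoryType T I n := by
  rintro _ ⟨B, hB, rfl⟩
  exact ⟨Prod.fst ⁻¹' B, measurable_fst hB, rfl⟩

lemma measurable_type_polyaHistoryType (n : ℕ) : Measurable[polyaHistoryType T I n] (I n) :=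
  measurable_snd.comp (comap_measurable _)

lemma measurable_polyaRenewalTime {m : MeasurableSpace Ω} {n : ℕ} (h : ∀ k < n, Measurable[m] (T k)) :
    Measurable[m] (polyaRenewalTime T n) := by
  unfold polyaRenewalTime
  exact Finset.measurable_fun_sum _ fun k hk => h k (Finset.mem_range.mp hk)

lemma measurable_polyaPosition {A : Matrix (Fin c) (Fin c) ℝ} {x₀ : Fin c → ℝ}
    {m : MeasurableSpace Ω} {n : ℕ} (h : ∀ k < n, Measurable[m] (I k)) :
    Measurable[m] (polyaPosition A x₀ I n) := by
  induction n with
  | zero => exact measurable_const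
  | succ n ih =>
    have h1 := ih fun k hk => h k (by omega)
    have h2 : Measurable[m] fun ω => A (I n ω) := (measurable_of_finite A).comp (h n (by omega))
    exact h1.add h2

end History

/-- Integrating out an independent variable. -/
lemma ProbabilityTheory.IndepFun.integral_comp_prodMk {Ω α β : Type*} {mΩ : MeasurableSpace Ω}
    {mα : MeasurableSpace α} {mβ : MeasurableSpace β} {P : Measure Ω} [IsProbabilityMeasure P]
    {W : Ω → α} {S : Ω → β} (h : IndepFun W S P) (hW : Measurable W) (hS : Measurable S)
    {Φ : α × β → ℝ} (hΦ : Measurable Φ) (hint : Integrable (fun ω => Φ (W ω, S ω)) P) :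
    ∫ ω, Φ (W ω, S ω) ∂P = ∫ ω, ∫ s, Φ (W ω, s) ∂(P.map S) ∂P := by
  have hmap := (indepFun_iff_map_prod_eq_prod_map_map hW.aemeasurable hS.aemeasurable).mp h
  have := Measure.isProbabilityMeasure_map (μ := P) hW.aemeasurable
  have := Measure.isProbabilityMeasure_map (μ := P) hS.aemeasurable
  have hint' : Integrable Φ ((P.map W).prod (P.map S)) := by
    rw [← hmap]
    exact (integrable_map_measure hΦ.aestronglyMeasurable (hW.prodMk hS).aemeasurable).mpr hint
  calc ∫ ω, Φ (W ω, S ω) ∂P = ∫ z, Φ z ∂(P.map fun ω => (W ω, S ω)) :=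
        (integral_map (hW.prodMk hS).aemeasurable hΦ.aestronglyMeasurable).symm
    _ = ∫ w, ∫ s, Φ (w, s) ∂(P.map S) ∂(P.map W) := by rw [hmap, integral_prod _ hint']
    _ = _ := integral_map hW.aemeasurable
        (hΦ.stronglyMeasurable.integral_prod_right' (ν := P.map S)).aestronglyMeasurable

lemma MeasureTheory.measureReal_eq_sum_inter_eq {Ω ι : Type*} {mΩ : MeasurableSpace Ω} [Fintype ι]
    [MeasurableSpace ι] [MeasurableSingletonClass ι] {P : Measure Ω} [IsFiniteMeasure P]
    {f : Ω → ι} (hf : Measurable f) (S : Set Ω) :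
    P.real S = ∑ i, P.real (S ∩ {ω | f ω = i}) := by
  have h1 := sum_measureReal_preimage_singleton (μ := P.restrict S) (f := f) Finset.univ
    (fun i _ => hf (measurableSet_singleton i))
  simp only [Finset.coe_univ, Set.preimage_univ, measureReal_restrict_apply_univ] at h1
  rw [← h1]
  refine Finset.sum_congr rfl fun i _ => ?_
  rw [measureReal_restrict_apply (hf (measurableSet_singleton i)), Set.inter_comm]
  rfl

/-! ### Clocks with constant total rate -/

namespace IsPolyaClock

variable {Ω : Type*} {mΩ : MeasurableSpace Ω} {c : ℕ} {A : Matrix (Fin c) (Fin c) ℝ}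
  {x₀ : Fin c → ℝ} {P : Measure Ω} {T : ℕ → Ω → ℝ} {I : ℕ → Ω → Fin c}

lemma polyaHistory_le (h : IsPolyaClock A x₀ P T I) (n : ℕ) : polyaHistory T I n ≤ mΩ :=
  (measurable_pi_lambda _ fun k : Fin n =>
    (h.measurable_time k).prodMk (h.measurable_type k)).comap_le

lemma polyaHistoryType_le (h : IsPolyaClock A x₀ P T I) (n : ℕ) : polyaHistoryType T I n ≤ mΩ :=
  ((measurable_pi_lambda _ fun k : Fin n =>
    (h.measurable_time k).prodMk (h.measurable_type k)).prodMk (h.measurable_type n)).comap_le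

lemma measurableSet_lt_and_eq (h : IsPolyaClock A x₀ P T I) (n : ℕ) (i : Fin c) (s : ℝ) :
    MeasurableSet {ω | s < T n ω ∧ I n ω = i} :=
  (measurableSet_lt measurable_const (h.measurable_time n)).inter
    (h.measurable_type n (measurableSet_singleton i))

variable {lam : ℝ}

lemma condExp_eq (h : IsPolyaClock A x₀ P T I)
    (hsum : ∀ n ω, ∑ j, polyaPosition A x₀ I n ω j = lam) (n : ℕ) (i : Fin c) {s : ℝ}
    (hs : 0 ≤ s) : P⟦{ω | s < T n ω ∧ I n ω = i} | polyaHistory T I n⟧ =ᵐ[P] fun ω =>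
      Real.exp (-(s * lam)) * (polyaPosition A x₀ I n ω i / lam) := by
  simpa only [hsum] using h.cond_law n i s hs

lemma integrable_polyaPosition_div (h : IsPolyaClock A x₀ P T I)
    (hsum : ∀ n ω, ∑ j, polyaPosition A x₀ I n ω j = lam) (n : ℕ) (i : Fin c) :
    Integrable (fun ω => polyaPosition A x₀ I n ω i / lam) P := by
  have := h.condExp_eq hsum n i le_rfl
  simp only [zero_mul, neg_zero, Real.exp_zero, one_mul] at this
  exact integrable_condExp.congr this

/-- At `s = 0` the conditional law makes the coordinate, divided by `lam`, a conditional
probability. No pathwise reachability argument is needed. -/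
lemma ae_polyaPosition_nonneg (h : IsPolyaClock A x₀ P T I) (hlam : 0 < lam)
    (hsum : ∀ n ω, ∑ j, polyaPosition A x₀ I n ω j = lam) :
    ∀ᵐ ω ∂P, ∀ n i, 0 ≤ polyaPosition A x₀ I n ω i := by
  simp only [ae_all_iff]
  intro n i
  have h1 := h.condExp_eq hsum n i le_rfl
  have h2 : 0 ≤ᵐ[P] P⟦{ω | 0 < T n ω ∧ I n ω = i} | polyaHistory T I n⟧ :=
    condExp_nonneg (ae_of_all _ fun ω => Set.indicator_nonneg (fun _ _ => zero_le_one) _)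
  filter_upwards [h1, h2] with ω h1 h2
  rw [h1] at h2
  simp only [Pi.zero_apply, zero_mul, neg_zero, Real.exp_zero, one_mul] at h2
  by_contra! hneg
  exact absurd h2 (not_le.mpr (div_neg_of_neg_of_pos hneg hlam))

variable [IsProbabilityMeasure P]

lemma measureReal_inter (h : IsPolyaClock A x₀ P T I)
    (hsum : ∀ n ω, ∑ j, polyaPosition A x₀ I n ω j = lam) {n : ℕ} {i : Fin c} {s : ℝ}
    (hs : 0 ≤ s) {B : Set Ω} (hB : MeasurableSet[polyaHistory T I n] B) :
    P.real (B ∩ {ω | s < T n ω ∧ I n ω = i}) =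
      Real.exp (-(s * lam)) * ∫ ω in B, polyaPosition A x₀ I n ω i / lam ∂P := by
  have hE := h.measurableSet_lt_and_eq n i s
  have hle := h.polyaHistory_le n
  have h1 : ∫ ω in B, (P⟦{ω | s < T n ω ∧ I n ω = i} | polyaHistory T I n⟧) ω ∂P =
      ∫ ω in B, {ω | s < T n ω ∧ I n ω = i}.indicator (fun _ => (1 : ℝ)) ω ∂P :=
    setIntegral_condExp hle ((integrable_const _).indicator hE) hB
  rw [setIntegral_congr_ae (hle _ hB) ((h.condExp_eq hsum n i hs).mono fun ω hω _ => hω),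
    integral_const_mul, setIntegral_indicator hE, setIntegral_const] at h1
  rw [h1]
  simp

/-- The type probabilities at `s = 0` sum to one, which leaves no mass for nonpositive waiting
times. -/
lemma ae_time_pos (h : IsPolyaClock A x₀ P T I) (hlam : 0 < lam)
    (hsum : ∀ n ω, ∑ j, polyaPosition A x₀ I n ω j = lam) : ∀ᵐ ω ∂P, ∀ n, 0 < T n ω := by
  rw [ae_all_iff]
  intro n
  have hm : MeasurableSet {ω | 0 < T n ω} := measurableSet_lt measurable_const (h.measurable_time n)
  have key : P.real {ω | 0 < T n ω} = 1 := by
    rw [measureReal_eq_sum_inter_eq (h.measurable_type n)]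
    calc ∑ i, P.real ({ω | 0 < T n ω} ∩ {ω | I n ω = i})
        = ∑ i, ∫ ω, polyaPosition A x₀ I n ω i / lam ∂P := by
          refine Finset.sum_congr rfl fun i _ => ?_
          have := h.measureReal_inter hsum (i := i) le_rfl
            (MeasurableSet.univ (m := polyaHistory T I n))
          simpa [Set.ofPred_and] using this
      _ = ∫ ω, ∑ i, polyaPosition A x₀ I n ω i / lam ∂P :=
          (integral_finsetSum _ fun i _ => h.integrable_polyaPosition_div hsum n i).symm
      _ = 1 := by simp [← Finset.sum_div, hsum, hlam.ne']
  have h1 : P {ω | 0 < T n ω} = 1 := by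
    rwa [measureReal_def, ENNReal.toReal_eq_one_iff] at key
  exact (mem_ae_iff_prob_eq_one hm).mpr h1

/-- With constant total rate the factor `exp (-(s * lam))` is deterministic, so it decouples from
the past even when the accompanying type is included. -/
lemma measureReal_inter_time (h : IsPolyaClock A x₀ P T I) (hlam : 0 < lam)
    (hsum : ∀ n ω, ∑ j, polyaPosition A x₀ I n ω j = lam) {n : ℕ} {s : ℝ}
    (hs : 0 ≤ s) {B : Set Ω} (hB : MeasurableSet[polyaHistoryType T I n] B) :
    P.real (B ∩ {ω | s < T n ω}) = Real.exp (-(s * lam)) * P.real B := by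
  obtain ⟨D, hD, rfl⟩ := hB
  set B := (fun ω => ((fun k : Fin n => (T k ω, I k ω)), I n ω)) ⁻¹' D
  -- `H i` is the section of `B` at next type `i`; it depends on the first `n` renewals only.
  let H : Fin c → Set Ω := fun i =>
    (fun ω => (fun k : Fin n => (T k ω, I k ω))) ⁻¹' ((fun z => (z, i)) ⁻¹' D)
  have hH (i) : MeasurableSet[polyaHistory T I n] (H i) :=
    ⟨_, measurable_prodMk_right hD, rfl⟩
  have key {r : ℝ} (hr : 0 ≤ r) : P.real (B ∩ {ω | r < T n ω}) = Real.exp (-(r * lam)) *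
      ∑ i, ∫ ω in H i, polyaPosition A x₀ I n ω i / lam ∂P := by
    rw [measureReal_eq_sum_inter_eq (h.measurable_type n), Finset.mul_sum]
    refine Finset.sum_congr rfl fun i _ => ?_
    rw [← h.measureReal_inter hsum hr (hH i)]
    congr 1
    ext ω
    simp only [B, H, Set.mem_inter_iff, Set.mem_preimage, Set.mem_ofPred_eq]
    constructor
    · rintro ⟨⟨h1, h2⟩, rfl⟩; exact ⟨h1, h2, rfl⟩
    · rintro ⟨h1, h2, rfl⟩; exact ⟨⟨h1, h2⟩, rfl⟩
  have h0 : P.real B = P.real (B ∩ {ω | 0 < T n ω}) := by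
    refine measureReal_congr ?_
    filter_upwards [h.ae_time_pos hlam hsum] with ω hω
    exact propext ⟨fun h => ⟨h, hω n⟩, fun h => h.1⟩
  rw [h0, key hs, key le_rfl]
  simp

lemma map_time (h : IsPolyaClock A x₀ P T I) (hlam : 0 < lam)
    (hsum : ∀ n ω, ∑ j, polyaPosition A x₀ I n ω j = lam) (n : ℕ) :
    P.map (T n) = expMeasure lam := by
  have := Measure.isProbabilityMeasure_map (μ := P) (h.measurable_time n).aemeasurable
  have := isProbabilityMeasure_expMeasure hlam
  have hpos {s : ℝ} (hs : 0 ≤ s) : P.real {ω | T n ω ≤ s} = 1 - Real.exp (-(s * lam)) := by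
    have h1 := h.measureReal_inter_time hlam hsum hs
      (MeasurableSet.univ (m := polyaHistoryType T I n))
    rw [Set.univ_inter, probReal_univ, mul_one] at h1
    rw [← h1, ← probReal_compl_eq_one_sub (measurableSet_lt measurable_const (h.measurable_time n))]
    congr 1; ext ω; simp
  refine Measure.eq_of_cdf _ _ ?_
  ext s
  rw [cdf_expMeasure_eq hlam, cdf_eq_real,
    map_measureReal_apply (h.measurable_time n) measurableSet_Iic]
  split_ifs with hs
  · rw [mul_comm lam]; exact hpos hs
  · refine le_antisymm ?_ measureReal_nonneg
    refine (measureReal_mono fun ω (hω : T n ω ≤ s) => ?_).trans_eq ((hpos le_rfl).trans (by simp))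
    exact hω.trans (not_le.mp hs).le

lemma indep_polyaHistoryType_time (h : IsPolyaClock A x₀ P T I) (hlam : 0 < lam)
    (hsum : ∀ n ω, ∑ j, polyaPosition A x₀ I n ω j = lam) (n : ℕ) :
    Indep (polyaHistoryType T I n) (MeasurableSpace.comap (T n) inferInstance) P := by
  rw [Indep_iff]
  rintro B _ hB ⟨E, hE, rfl⟩
  have hB' : MeasurableSet B := h.polyaHistoryType_le n _ hB
  have hT := h.measurable_time n
  have h1 {s : ℝ} (hs : 0 ≤ s) : P (B ∩ {ω | s < T n ω}) = P B * P {ω | s < T n ω} := by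
    have h2 := h.measureReal_inter_time hlam hsum hs hB
    have h3 := h.measureReal_inter_time hlam hsum hs
      (MeasurableSet.univ (m := polyaHistoryType T I n))
    rw [Set.univ_inter, probReal_univ, mul_one] at h3
    rw [← h3] at h2
    rw [← ENNReal.toReal_eq_toReal_iff' (by finiteness) (by finiteness), ENNReal.toReal_mul,
      mul_comm]
    exact h2
  suffices hm : (P.restrict B).map (T n) = (P B) • P.map (T n) by
    have := congrArg (fun μ => μ E) hm
    simp only [Measure.smul_apply, smul_eq_mul, Measure.map_apply hT hE,
      Measure.restrict_apply (hT hE)] at this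
    rwa [Set.inter_comm]
  refine Measure.ext_of_Iic _ _ fun s => ?_
  rw [Measure.smul_apply, smul_eq_mul, Measure.map_apply hT measurableSet_Iic,
    Measure.map_apply hT measurableSet_Iic, Measure.restrict_apply (hT measurableSet_Iic),
    Set.inter_comm]
  rcases le_or_gt 0 s with hs | hs
  · have hE : MeasurableSet {ω | s < T n ω} := measurableSet_lt measurable_const hT
    have h2 : T n ⁻¹' Set.Iic s = {ω | s < T n ω}ᶜ := by ext ω; simp
    have h3 : B ∩ {ω | s < T n ω}ᶜ = B \ (B ∩ {ω | s < T n ω}) := by ext ω; simp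
    rw [h2, h3, measure_sdiff Set.inter_subset_left (hB'.inter hE).nullMeasurableSet (by finiteness),
      h1 hs, prob_compl_eq_one_sub hE, ENNReal.mul_sub (fun _ _ => by finiteness), mul_one]
  · have h2 : P (T n ⁻¹' Set.Iic s) = 0 := by
      refine measure_mono_null ?_ (ae_iff.mp (h.ae_time_pos hlam hsum))
      intro ω hω hpos
      exact absurd (hpos n) (not_lt.mpr (le_trans hω hs.le))
    rw [h2, mul_zero]
    exact measure_mono_null Set.inter_subset_right h2

lemma integral_comp_time (h : IsPolyaClock A x₀ P T I) (hlam : 0 < lam)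
    (hsum : ∀ n ω, ∑ j, polyaPosition A x₀ I n ω j = lam) {n : ℕ} {α : Type*}
    {mα : MeasurableSpace α} {W : Ω → α} (hW : Measurable[polyaHistoryType T I n] W)
    {Φ : α × ℝ → ℝ} (hΦ : Measurable Φ) (hint : Integrable (fun ω => Φ (W ω, T n ω)) P) :
    ∫ ω, Φ (W ω, T n ω) ∂P = ∫ ω, ∫ s, Φ (W ω, s) ∂(expMeasure lam) ∂P := by
  have hind : IndepFun W (T n) P :=
    (IndepFun_iff_Indep _ _ _).mpr (indep_of_indep_of_le_left
      (h.indep_polyaHistoryType_time hlam hsum n) hW.comap_le)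
  rw [hind.integral_comp_prodMk (hW.mono (h.polyaHistoryType_le n) le_rfl) (h.measurable_time n)
    hΦ hint, h.map_time hlam hsum n]

/-- Given the past, the next renewal has type `i` with probability proportional to the `i`-th
coordinate of the current position. -/
lemma integral_mul_indicator_type (h : IsPolyaClock A x₀ P T I) (hlam : 0 < lam)
    (hsum : ∀ n ω, ∑ j, polyaPosition A x₀ I n ω j = lam) {n : ℕ} (i : Fin c) {V : Ω → ℝ}
    (hV : Measurable[polyaHistory T I n] V) (hVi : Integrable V P) :
    ∫ ω, V ω * {ω | I n ω = i}.indicator 1 ω ∂P =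
      ∫ ω, V ω * (polyaPosition A x₀ I n ω i / lam) ∂P := by
  have hE := h.measurableSet_lt_and_eq n i 0
  have hle := h.polyaHistory_le n
  have h1 : ∫ ω, V ω * {ω | I n ω = i}.indicator 1 ω ∂P =
      ∫ ω, (V * {ω | 0 < T n ω ∧ I n ω = i}.indicator fun _ => (1 : ℝ)) ω ∂P := by
    refine integral_congr_ae ?_
    filter_upwards [h.ae_time_pos hlam hsum] with ω hω
    by_cases hi : I n ω = i <;> simp [hi, hω n]
  have hint : Integrable (V * {ω | 0 < T n ω ∧ I n ω = i}.indicator fun _ => (1 : ℝ)) P := by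
    have := hVi.indicator hE
    refine this.congr (ae_of_all _ fun ω => ?_)
    simp only [Set.indicator, Pi.mul_apply]
    split_ifs <;> simp
  rw [h1, ← integral_condExp hle]
  refine integral_congr_ae ?_
  filter_upwards [condExp_mul_of_stronglyMeasurable_left hV.stronglyMeasurable hint
    ((integrable_const _).indicator hE), h.condExp_eq hsum n i le_rfl] with ω h2 h3
  rw [h2, Pi.mul_apply, h3]
  simp

end IsPolyaClock

/-! ### Tilted powers of renewal times -/

/-- The exponentially tilted truncated power `exp (lam * τ) * (t - τ) ^ m` on `τ ≤ t`. -/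
noncomputable def tiltedPow (lam t : ℝ) (m : ℕ) (τ : ℝ) : ℝ :=
  if τ ≤ t then Real.exp (lam * τ) * (t - τ) ^ m else 0

lemma measurable_tiltedPow (lam t : ℝ) (m : ℕ) : Measurable (tiltedPow lam t m) :=
  Measurable.ite measurableSet_Iic (by fun_prop) measurable_const

lemma norm_tiltedPow_le {lam t τ : ℝ} (hlam : 0 ≤ lam) (m : ℕ) (hτ : 0 ≤ τ) :
    ‖tiltedPow lam t m τ‖ ≤ Real.exp (lam * |t|) * |t| ^ m := by
  unfold tiltedPow
  split_ifs with h
  · have h0 : 0 ≤ t - τ := by linarith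
    have h1 : t ≤ |t| := le_abs_self t
    rw [norm_mul, Real.norm_of_nonneg (Real.exp_pos _).le, Real.norm_of_nonneg (by positivity)]
    gcongr
    · linarith
    · linarith
  · simp only [norm_zero]; positivity

/-- The tilt cancels the exponential density, so averaging over one waiting time just integrates a
power and raises its exponent by one. -/
lemma integral_expMeasure_tiltedPow {lam : ℝ} (hlam : 0 < lam) (t : ℝ) (m : ℕ) (τ : ℝ) :
    ∫ s, tiltedPow lam t m (τ + s) ∂(expMeasure lam) =
      lam / (m + 1) * tiltedPow lam t (m + 1) τ := by
  have h1 : ∫ s, tiltedPow lam t m (τ + s) ∂(expMeasure lam) =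
      ∫ s, exponentialPDFReal lam s * tiltedPow lam t m (τ + s) := by
    have hm : Measurable fun s => (exponentialPDFReal lam s).toNNReal := by fun_prop
    change ∫ s, _ ∂(volume.withDensity fun s => ((exponentialPDFReal lam s).toNNReal : ENNReal)) = _
    rw [integral_withDensity_eq_integral_smul hm]
    refine integral_congr_ae (ae_of_all _ fun s => ?_)
    simp [NNReal.smul_def, exponentialPDFReal_nonneg hlam]
  have h2 : (fun s => exponentialPDFReal lam s * tiltedPow lam t m (τ + s)) =
      (Set.Icc 0 (t - τ)).indicator fun s => lam * Real.exp (lam * τ) * (t - τ - s) ^ m := by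
    ext s
    simp only [exponentialPDFReal, gammaPDFReal, tiltedPow, Set.indicator, Set.mem_Icc]
    by_cases hs : 0 ≤ s
    · by_cases hs' : τ + s ≤ t
      · rw [if_pos hs, if_pos hs', if_pos ⟨hs, by linarith⟩]
        have : Real.exp (lam * (τ + s)) = Real.exp (lam * τ) * Real.exp (lam * s) := by
          rw [← Real.exp_add]; ring_nf
        rw [this, Real.exp_neg]
        have := Real.exp_pos (lam * s)
        simp
        field_simp
        rw [sub_sub]
      · rw [if_neg hs', if_neg (fun h : 0 ≤ s ∧ s ≤ t - τ => hs' (by linarith [h.2])), mul_zero]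
    · rw [if_neg hs, if_neg (fun h : 0 ≤ s ∧ s ≤ t - τ => hs h.1), zero_mul]
  rw [h1, h2, integral_indicator measurableSet_Icc, integral_Icc_eq_integral_Ioc]
  unfold tiltedPow
  split_ifs with h
  · rw [← intervalIntegral.integral_of_le (by linarith), intervalIntegral.integral_const_mul,
      intervalIntegral.integral_comp_sub_left (fun x => x ^ m), integral_pow]
    simp
    ring
  · rw [Set.Ioc_eq_empty (by intro h'; exact h (by linarith))]
    simp

/-! ### The embedded Ehrenfest chain -/

/-- The number of particles in the first urn after `n` renewals, when `k₀` are there initially. -/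
def ehrenfestCount {Ω : Type*} (k₀ : ℕ) (I : ℕ → Ω → Fin 2) : ℕ → Ω → ℤ
  | 0, _ => k₀
  | n + 1, ω => ehrenfestCount k₀ I n ω + ![-1, 1] (I n ω)

section Ehrenfest

variable {Ω : Type*} {γ : ℝ} {k₀ N : ℕ} {T : ℕ → Ω → ℝ} {I : ℕ → Ω → Fin 2}

lemma polyaPosition_ehrenfest (n : ℕ) (ω : Ω) :
    polyaPosition (ehrenfestMatrix γ) ![γ * k₀, γ * (N - k₀)] I n ω =
      ![γ * ehrenfestCount k₀ I n ω, γ * (N - ehrenfestCount k₀ I n ω)] := by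
  induction n with
  | zero => simp [polyaPosition, ehrenfestCount]
  | succ n ih =>
    rw [polyaPosition, ih, ehrenfestCount]
    generalize I n ω = i
    ext j
    fin_cases i <;> fin_cases j <;> simp [ehrenfestMatrix] <;> ring

lemma sum_polyaPosition_ehrenfest (n : ℕ) (ω : Ω) :
    ∑ j, polyaPosition (ehrenfestMatrix γ) ![γ * k₀, γ * (N - k₀)] I n ω j = γ * N := by
  rw [polyaPosition_ehrenfest, Fin.sum_univ_two]
  simp
  ring

lemma measurable_ehrenfestCount {m : MeasurableSpace Ω} {n : ℕ}
    (h : ∀ k < n, Measurable[m] (I k)) : Measurable[m] (ehrenfestCount k₀ I n) := by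
  induction n with
  | zero => exact measurable_const
  | succ n ih =>
    exact (ih fun k hk => h k (by omega)).add
      ((measurable_of_finite (![-1, 1] : Fin 2 → ℤ)).comp (h n (by omega)))

namespace IsPolyaClock

variable {mΩ : MeasurableSpace Ω} {P : Measure Ω}

lemma ae_ehrenfestCount_mem (hγ : 0 < γ) (hN : 0 < N)
    (h : IsPolyaClock (ehrenfestMatrix γ) ![γ * k₀, γ * (N - k₀)] P T I) :
    ∀ᵐ ω ∂P, ∀ n, 0 ≤ ehrenfestCount k₀ I n ω ∧ ehrenfestCount k₀ I n ω ≤ N := by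
  filter_upwards [h.ae_polyaPosition_nonneg (by positivity) sum_polyaPosition_ehrenfest] with ω hω n
  have h0 := hω n 0
  have h1 := hω n 1
  rw [polyaPosition_ehrenfest] at h0 h1
  simp only [Matrix.cons_val_zero, Matrix.cons_val_one, hγ, mul_nonneg_iff_of_pos_left] at h0 h1
  constructor
  · exact_mod_cast h0
  · have : (ehrenfestCount k₀ I n ω : ℝ) ≤ (N : ℤ) := by push_cast; linarith
    exact_mod_cast this

lemma measurable_ehrenfestCount {x₀ : Fin 2 → ℝ} (h : IsPolyaClock (ehrenfestMatrix γ) x₀ P T I)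
    (n : ℕ) : Measurable (ehrenfestCount k₀ I n) :=
  _root_.measurable_ehrenfestCount fun k _ => h.measurable_type k

lemma measurable_polyaRenewalTime {c : ℕ} {A : Matrix (Fin c) (Fin c) ℝ} {x₀ : Fin c → ℝ}
    {I : ℕ → Ω → Fin c} (h : IsPolyaClock A x₀ P T I) (n : ℕ) :
    Measurable (polyaRenewalTime T n) :=
  _root_.measurable_polyaRenewalTime fun k _ => h.measurable_time k

variable [IsProbabilityMeasure P]

lemma ae_polyaRenewalTime_nonneg {c : ℕ} {A : Matrix (Fin c) (Fin c) ℝ} {x₀ : Fin c → ℝ}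
    {I : ℕ → Ω → Fin c} {lam : ℝ} (h : IsPolyaClock A x₀ P T I) (hlam : 0 < lam)
    (hsum : ∀ n ω, ∑ j, polyaPosition A x₀ I n ω j = lam) :
    ∀ᵐ ω ∂P, ∀ n, 0 ≤ polyaRenewalTime T n ω := by
  filter_upwards [h.ae_time_pos hlam hsum] with ω hω n
  exact Finset.sum_nonneg fun k _ => (hω k).le

/-- A bounded eigenfunction `f` of the Ehrenfest chain with eigenvalue `μ` is multiplied by `μ` in
conditional expectation at each renewal. -/
lemma integral_ehrenfestCount_succ_mul (hγ : 0 < γ) (hN : 0 < N)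
    (h : IsPolyaClock (ehrenfestMatrix γ) ![γ * k₀, γ * (N - k₀)] P T I) {f : ℤ → ℝ} {C μ : ℝ}
    (hC : ∀ k, ‖f k‖ ≤ C)
    (hf : ∀ k : ℤ, 0 ≤ k → k ≤ N → k * f (k - 1) + (N - k) * f (k + 1) = N * μ * f k) (n : ℕ)
    {g : ℝ → ℝ} (hg : Measurable g) (hgi : Integrable (fun ω => g (polyaRenewalTime T n ω)) P) :
    ∫ ω, f (ehrenfestCount k₀ I (n + 1) ω) * g (polyaRenewalTime T n ω) ∂P =
      μ * ∫ ω, f (ehrenfestCount k₀ I n ω) * g (polyaRenewalTime T n ω) ∂P := by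
  have hsum := sum_polyaPosition_ehrenfest (γ := γ) (k₀ := k₀) (N := N) (I := I)
  have hlam : 0 < γ * N := by positivity
  -- Fixing the next type as `i` makes the integrand measurable with respect to the past, so the
  -- conditional law of the type applies.
  let V : Fin 2 → Ω → ℝ := fun i ω =>
    f (ehrenfestCount k₀ I n ω + ![-1, 1] i) * g (polyaRenewalTime T n ω)
  have hVm (i) : Measurable[polyaHistory T I n] (V i) :=
    ((measurable_of_countable fun k => f (k + ![-1, 1] i)).comp
      (_root_.measurable_ehrenfestCount fun k hk => measurable_type_polyaHistory hk)).mul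
      (hg.comp (_root_.measurable_polyaRenewalTime fun k hk => measurable_time_polyaHistory hk))
  have hVi (i) : Integrable (V i) P :=
    hgi.bdd_mul (((measurable_of_countable fun k => f (k + ![-1, 1] i)).comp
      (h.measurable_ehrenfestCount n))).aestronglyMeasurable (c := C) (ae_of_all _ fun _ => hC _)
  have hVind (i) : Integrable (fun ω => V i ω * {ω | I n ω = i}.indicator 1 ω) P := by
    refine ((hVi i).indicator (h.measurable_type n (measurableSet_singleton i))).congr
      (ae_of_all _ fun ω => ?_)
    by_cases hi : I n ω = i <;> simp [Set.indicator, hi]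
  have hK := h.ae_ehrenfestCount_mem hγ hN
  have hVp (i) : Integrable (fun ω => V i ω *
      (polyaPosition (ehrenfestMatrix γ) ![γ * k₀, γ * (N - k₀)] I n ω i / (γ * N))) P := by
    refine (hVi i).mul_bdd (c := 1)
      (((measurable_pi_apply i).comp
        (measurable_polyaPosition fun k _ => h.measurable_type k)).div_const _).aestronglyMeasurable ?_
    filter_upwards [h.ae_polyaPosition_nonneg hlam hsum] with ω hω
    rw [Real.norm_of_nonneg (div_nonneg (hω n i) hlam.le), div_le_one hlam, ← hsum n ω]
    exact Finset.single_le_sum (f := fun i => polyaPosition _ _ I n ω i)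
      (fun j _ => hω n j) (Finset.mem_univ i)
  calc ∫ ω, f (ehrenfestCount k₀ I (n + 1) ω) * g (polyaRenewalTime T n ω) ∂P
      = ∫ ω, ∑ i, V i ω * {ω | I n ω = i}.indicator 1 ω ∂P := by
        refine integral_congr_ae (ae_of_all _ fun ω => ?_)
        simp only [Set.indicator, Set.mem_ofPred_eq, Pi.one_apply, mul_ite, mul_one, mul_zero,
          Finset.sum_ite_eq, Finset.mem_univ, if_true]
        rfl
    _ = ∑ i, ∫ ω, V i ω * {ω | I n ω = i}.indicator 1 ω ∂P := integral_finsetSum _ fun i _ => hVind i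
    _ = ∑ i, ∫ ω, V i ω *
        (polyaPosition (ehrenfestMatrix γ) ![γ * k₀, γ * (N - k₀)] I n ω i / (γ * N)) ∂P :=
        Finset.sum_congr rfl fun i _ => h.integral_mul_indicator_type hlam hsum i (hVm i) (hVi i)
    _ = ∫ ω, ∑ i, V i ω *
        (polyaPosition (ehrenfestMatrix γ) ![γ * k₀, γ * (N - k₀)] I n ω i / (γ * N)) ∂P :=
        (integral_finsetSum _ fun i _ => hVp i).symm
    _ = ∫ ω, μ * (f (ehrenfestCount k₀ I n ω) * g (polyaRenewalTime T n ω)) ∂P := by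
        refine integral_congr_ae ?_
        filter_upwards [hK] with ω hω
        have := hf _ (hω n).1 (hω n).2
        rw [Fin.sum_univ_two, polyaPosition_ehrenfest]
        simp only [V, Matrix.cons_val_zero, Matrix.cons_val_one]
        have hN' : (N : ℝ) ≠ 0 := by positivity
        rw [← sub_eq_add_neg]
        field_simp
        linear_combination g (polyaRenewalTime T n ω) * this
    _ = _ := integral_const_mul _ _

/-- Each renewal contributes `μ` from the eigenfunction and `γN / (m + 1)` from the waiting time,
trading `n + 1, m` for `n, m + 1`; hence the induction keeps `m` general. -/
lemma integral_ehrenfestCount_mul_tiltedPow (hγ : 0 < γ) (hN : 0 < N)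
    (h : IsPolyaClock (ehrenfestMatrix γ) ![γ * k₀, γ * (N - k₀)] P T I) {f : ℤ → ℝ} {C μ : ℝ}
    (hC : ∀ k, ‖f k‖ ≤ C)
    (hf : ∀ k : ℤ, 0 ≤ k → k ≤ N → k * f (k - 1) + (N - k) * f (k + 1) = N * μ * f k)
    {t : ℝ} (ht : 0 ≤ t) (n m : ℕ) :
    ∫ ω, f (ehrenfestCount k₀ I n ω) * tiltedPow (γ * N) t m (polyaRenewalTime T n ω) ∂P =
      f k₀ * ((μ * (γ * N)) ^ n * t ^ (n + m) * (m.factorial / (n + m).factorial)) := by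
  have hsum := sum_polyaPosition_ehrenfest (γ := γ) (k₀ := k₀) (N := N) (I := I)
  have hlam : 0 < γ * N := by positivity
  have hint (n m : ℕ) :
      Integrable (fun ω => tiltedPow (γ * N) t m (polyaRenewalTime T n ω)) P := by
    refine Integrable.of_bound ((measurable_tiltedPow _ _ _).comp
      (h.measurable_polyaRenewalTime n)).aestronglyMeasurable
      (Real.exp (γ * N * |t|) * |t| ^ m) ?_
    filter_upwards [h.ae_polyaRenewalTime_nonneg hlam hsum] with ω hω
    exact norm_tiltedPow_le hlam.le m (hω n)
  induction n generalizing m with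
  | zero =>
    have hm : (m.factorial : ℝ) ≠ 0 := by positivity
    simp [ehrenfestCount, polyaRenewalTime, tiltedPow, ht, hm]
  | succ n ih =>
    -- The next count already uses the type `I n`, so independence of `T n` is needed from the past
    -- enlarged by that type.
    have hW : Measurable[polyaHistoryType T I n]
        fun ω => (ehrenfestCount k₀ I (n + 1) ω, polyaRenewalTime T n ω) := by
      refine Measurable.prodMk (_root_.measurable_ehrenfestCount fun k hk => ?_)
        (_root_.measurable_polyaRenewalTime fun k hk =>
          (measurable_time_polyaHistory hk).mono (polyaHistory_le_polyaHistoryType n) le_rfl)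
      rcases Nat.lt_succ_iff_lt_or_eq.mp hk with hk | rfl
      · exact (measurable_type_polyaHistory hk).mono (polyaHistory_le_polyaHistoryType n) le_rfl
      · exact measurable_type_polyaHistoryType k
    have hτ (ω) : polyaRenewalTime T (n + 1) ω = polyaRenewalTime T n ω + T n ω :=
      Finset.sum_range_succ _ _
    let Φ : (ℤ × ℝ) × ℝ → ℝ := fun z => f z.1.1 * tiltedPow (γ * N) t m (z.1.2 + z.2)
    have hΦ : Measurable Φ :=
      ((measurable_of_countable f).comp (measurable_fst.comp measurable_fst)).mul
        ((measurable_tiltedPow _ _ _).comp (by fun_prop))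
    have hΦi : Integrable (fun ω =>
        Φ ((ehrenfestCount k₀ I (n + 1) ω, polyaRenewalTime T n ω), T n ω)) P := by
      simp only [Φ, ← hτ]
      exact (hint (n + 1) m).bdd_mul (((measurable_of_countable f).comp
        (h.measurable_ehrenfestCount (n + 1)))).aestronglyMeasurable (c := C) (ae_of_all _ fun _ => hC _)
    have key := h.integral_comp_time hlam hsum hW hΦ hΦi
    simp only [Φ, integral_const_mul, integral_expMeasure_tiltedPow hlam] at key
    simp only [hτ]
    rw [key]
    have := h.integral_ehrenfestCount_succ_mul hγ hN hC hf n
      ((measurable_tiltedPow (γ * N) t (m + 1)).const_mul (γ * N / (m + 1)))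
      ((hint n (m + 1)).const_mul _)
    rw [this]
    simp only [mul_left_comm (f _), integral_const_mul]
    rw [ih (m + 1), show n + (m + 1) = n + 1 + m by ring, Nat.factorial_succ m]
    have h1 : ((n + 1 + m).factorial : ℝ) ≠ 0 := by positivity
    have h2 : (m : ℝ) + 1 ≠ 0 := by positivity
    push_cast
    field_simp
    ring

end IsPolyaClock

end Ehrenfest

/-! ### Non-explosion and expectations between renewals -/

lemma expMeasure_real_Ioi {lam r : ℝ} (hlam : 0 < lam) (hr : 0 ≤ r) :
    (expMeasure lam).real (Set.Ioi r) = Real.exp (-(lam * r)) := by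
  have := isProbabilityMeasure_expMeasure hlam
  have h1 := cdf_expMeasure_eq hlam r
  rw [if_pos hr, cdf_eq_real] at h1
  rw [← Set.compl_Iic, probReal_compl_eq_one_sub measurableSet_Iic, h1]
  ring

namespace IsPolyaClock

variable {Ω : Type*} {γ : ℝ} {k₀ N : ℕ} {T : ℕ → Ω → ℝ} {I : ℕ → Ω → Fin 2}
  {mΩ : MeasurableSpace Ω} {P : Measure Ω} [IsProbabilityMeasure P]

/-- The probability of at least `n` renewals by time `M` is at most `(γNM) ^ n / n!`, which tends to
zero. -/
lemma ae_exists_lt_polyaRenewalTime (hγ : 0 < γ) (hN : 0 < N)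
    (h : IsPolyaClock (ehrenfestMatrix γ) ![γ * k₀, γ * (N - k₀)] P T I) :
    ∀ᵐ ω ∂P, ∀ M : ℕ, ∃ n, (M : ℝ) < polyaRenewalTime T n ω := by
  have hsum := sum_polyaPosition_ehrenfest (γ := γ) (k₀ := k₀) (N := N) (I := I)
  have hlam : 0 < γ * N := by positivity
  rw [ae_all_iff]
  intro M
  have hbound (n : ℕ) : P.real {ω | ∀ n, polyaRenewalTime T n ω ≤ M} ≤
      (γ * N * M) ^ n / n.factorial := by
    -- The constant eigenfunction leaves `exp (γNτ)` on `τ ≤ M`, which dominates the indicator of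
    -- that event.
    have h1 := h.integral_ehrenfestCount_mul_tiltedPow hγ hN (f := fun _ => 1) (C := 1) (μ := 1)
      (by simp) (by intros; ring) (Nat.cast_nonneg (α := ℝ) M) n 0
    simp only [one_mul, add_zero, Nat.factorial_zero, Nat.cast_one] at h1
    have hm : MeasurableSet {ω | polyaRenewalTime T n ω ≤ M} :=
      measurableSet_le (h.measurable_polyaRenewalTime n) measurable_const
    have hint : Integrable (fun ω => tiltedPow (γ * N) M 0 (polyaRenewalTime T n ω)) P := by
      refine Integrable.of_bound ((measurable_tiltedPow _ _ _).comp
        (h.measurable_polyaRenewalTime n)).aestronglyMeasurable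
        (Real.exp (γ * N * |(M : ℝ)|) * |(M : ℝ)| ^ 0) ?_
      filter_upwards [h.ae_polyaRenewalTime_nonneg hlam hsum] with ω hω
      exact norm_tiltedPow_le hlam.le 0 (hω n)
    calc P.real {ω | ∀ n, polyaRenewalTime T n ω ≤ M}
        ≤ P.real {ω | polyaRenewalTime T n ω ≤ M} := measureReal_mono fun ω hω => hω n
      _ = ∫ ω, {ω | polyaRenewalTime T n ω ≤ M}.indicator 1 ω ∂P := (integral_indicator_one hm).symm
      _ ≤ ∫ ω, tiltedPow (γ * N) M 0 (polyaRenewalTime T n ω) ∂P := by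
        refine integral_mono_ae ((integrable_const _).indicator hm) hint ?_
        filter_upwards [h.ae_polyaRenewalTime_nonneg hlam hsum] with ω hω
        simp only [Set.indicator, Set.mem_ofPred_eq, tiltedPow, pow_zero, mul_one, Pi.one_apply]
        split_ifs
        · exact Real.one_le_exp (mul_nonneg hlam.le (hω n))
        · exact le_rfl
      _ = _ := by rw [h1, mul_pow (γ * N)]; ring
  have hzero : P.real {ω | ∀ n, polyaRenewalTime T n ω ≤ M} = 0 :=
    le_antisymm (ge_of_tendsto' (FloorSemiring.tendsto_pow_div_factorial_atTop _) hbound)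
      measureReal_nonneg
  rw [measureReal_eq_zero_iff] at hzero
  rw [ae_iff]
  convert hzero using 3
  simp

lemma ae_exists_polyaRenewalTime_le_lt (hγ : 0 < γ) (hN : 0 < N)
    (h : IsPolyaClock (ehrenfestMatrix γ) ![γ * k₀, γ * (N - k₀)] P T I) :
    ∀ᵐ ω ∂P, ∀ t : ℝ≥0, ∃ n, polyaRenewalTime T n ω ≤ t ∧ t < polyaRenewalTime T (n + 1) ω := by
  filter_upwards [h.ae_exists_lt_polyaRenewalTime hγ hN] with ω hω t
  have hex : ∃ n, (t : ℝ) < polyaRenewalTime T n ω := by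
    obtain ⟨M, hM⟩ := exists_nat_ge (t : ℝ)
    obtain ⟨n, hn⟩ := hω M
    exact ⟨n, hM.trans_lt hn⟩
  classical
  obtain ⟨n, hn⟩ : ∃ n, Nat.find hex = n + 1 := by
    refine Nat.exists_eq_succ_of_ne_zero fun h0 => ?_
    have := Nat.find_spec hex
    rw [h0] at this
    simp only [polyaRenewalTime, Finset.range_zero, Finset.sum_empty] at this
    exact absurd this (not_lt.mpr t.2)
  refine ⟨n, ?_, hn ▸ Nat.find_spec hex⟩
  exact not_lt.mp (Nat.find_min hex (by omega))

/-- Given the past, the next renewal falls after `t` with probability `exp (-γN(t - τ))` when `τ ≤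
t`: this is `exp (-γNt)` times the tilted power with `m = 0`. -/
lemma setIntegral_ehrenfestCount (hγ : 0 < γ) (hN : 0 < N)
    (h : IsPolyaClock (ehrenfestMatrix γ) ![γ * k₀, γ * (N - k₀)] P T I) {f : ℤ → ℝ} {C μ : ℝ}
    (hC : ∀ k, ‖f k‖ ≤ C)
    (hf : ∀ k : ℤ, 0 ≤ k → k ≤ N → k * f (k - 1) + (N - k) * f (k + 1) = N * μ * f k)
    {t : ℝ} (ht : 0 ≤ t) (n : ℕ) :
    ∫ ω in {ω | polyaRenewalTime T n ω ≤ t ∧ t < polyaRenewalTime T (n + 1) ω},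
      f (ehrenfestCount k₀ I n ω) ∂P =
      Real.exp (-(γ * N * t)) * f k₀ * ((μ * (γ * N) * t) ^ n / n.factorial) := by
  have hsum := sum_polyaPosition_ehrenfest (γ := γ) (k₀ := k₀) (N := N) (I := I)
  have hlam : 0 < γ * N := by positivity
  have hW : Measurable[polyaHistoryType T I n]
      fun ω => (ehrenfestCount k₀ I n ω, polyaRenewalTime T n ω) :=
    (Measurable.prodMk (_root_.measurable_ehrenfestCount fun k hk => measurable_type_polyaHistory hk)
      (_root_.measurable_polyaRenewalTime fun k hk => measurable_time_polyaHistory hk)).mono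
      (polyaHistory_le_polyaHistoryType n) le_rfl
  let S : Set ((ℤ × ℝ) × ℝ) := {z | z.1.2 ≤ t ∧ t < z.1.2 + z.2}
  have hS : MeasurableSet S :=
    (measurableSet_le (f := fun z : (ℤ × ℝ) × ℝ => z.1.2) (by fun_prop) measurable_const).inter
      (measurableSet_lt (g := fun z : (ℤ × ℝ) × ℝ => z.1.2 + z.2) measurable_const (by fun_prop))
  let Φ : (ℤ × ℝ) × ℝ → ℝ := S.indicator fun z => f z.1.1
  have hΦ : Measurable Φ :=
    ((measurable_of_countable f).comp (measurable_fst.comp measurable_fst)).indicator hS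
  have hΦi : Integrable (fun ω =>
      Φ ((ehrenfestCount k₀ I n ω, polyaRenewalTime T n ω), T n ω)) P := by
    refine Integrable.of_bound (hΦ.comp ((hW.mono (h.polyaHistoryType_le n) le_rfl).prodMk
      (h.measurable_time n))).aestronglyMeasurable C (ae_of_all _ fun ω => ?_)
    exact (norm_indicator_le_norm_self _ _).trans (hC _)
  have hτ (ω) : polyaRenewalTime T (n + 1) ω = polyaRenewalTime T n ω + T n ω :=
    Finset.sum_range_succ _ _
  have hin (k : ℤ) (τ : ℝ) : ∫ s, Φ ((k, τ), s) ∂(expMeasure (γ * N)) =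
      Real.exp (-(γ * N * t)) * (f k * tiltedPow (γ * N) t 0 τ) := by
    unfold tiltedPow
    split_ifs with hle
    · have : (fun s => Φ ((k, τ), s)) = (Set.Ioi (t - τ)).indicator fun _ => f k := by
        ext s
        simp only [Φ, S, Set.indicator, Set.mem_ofPred_eq, Set.mem_Ioi, hle, true_and,
          sub_lt_iff_lt_add']
      rw [this, integral_indicator_const _ measurableSet_Ioi,
        expMeasure_real_Ioi hlam (by linarith), smul_eq_mul]
      rw [show -(γ * N * (t - τ)) = -(γ * N * t) + γ * N * τ by ring, Real.exp_add]
      ring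
    · simp [Φ, S, hle]
  have hm : MeasurableSet {ω | polyaRenewalTime T n ω ≤ t ∧ t < polyaRenewalTime T (n + 1) ω} :=
    (measurableSet_le (h.measurable_polyaRenewalTime n) measurable_const).inter
      (measurableSet_lt measurable_const (h.measurable_polyaRenewalTime (n + 1)))
  have h1 := h.integral_comp_time hlam hsum hW hΦ hΦi
  simp only [hin, integral_const_mul] at h1
  rw [h.integral_ehrenfestCount_mul_tiltedPow hγ hN hC hf ht] at h1
  rw [← integral_indicator hm]
  have h2 : ∀ ω, {ω | polyaRenewalTime T n ω ≤ t ∧ t < polyaRenewalTime T (n + 1) ω}.indicator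
      (fun ω => f (ehrenfestCount k₀ I n ω)) ω =
      Φ ((ehrenfestCount k₀ I n ω, polyaRenewalTime T n ω), T n ω) := by
    intro ω
    simp only [Φ, S, Set.indicator, Set.mem_ofPred_eq, hτ]
  simp only [h2, h1]
  simp only [add_zero, Nat.factorial_zero, Nat.cast_one]
  rw [mul_pow (μ * (γ * N))]
  ring

end IsPolyaClock

/-! ### The walk at a fixed time -/

namespace IsPolyaWalk

variable {Ω : Type*} {γ : ℝ} {k₀ N : ℕ} {mΩ : MeasurableSpace Ω} {P : Measure Ω}
  [IsProbabilityMeasure P] {X : ℝ≥0 → Ω → Fin 2 → ℝ}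

lemma ae_exists_eq (hγ : 0 < γ) (hN : 0 < N)
    (h : IsPolyaWalk (ehrenfestMatrix γ) ![γ * k₀, γ * (N - k₀)] P X) :
    ∀ᵐ ω ∂P, ∀ t, ∃ k : ℕ, k ≤ N ∧ X t ω = ![γ * k, γ * (N - k)] := by
  obtain ⟨T, I, hc, hX⟩ := h
  filter_upwards [hX, hc.ae_ehrenfestCount_mem hγ hN, hc.ae_exists_polyaRenewalTime_le_lt hγ hN]
    with ω hX hK hex t
  obtain ⟨n, hn⟩ := hex t
  obtain ⟨k, hk⟩ := Int.eq_ofNat_of_zero_le (hK n).1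
  have := (hK n).2
  refine ⟨k, by omega, ?_⟩
  rw [hX n t hn.1 hn.2, polyaPosition_ehrenfest, hk]
  simp

/-- `IsPolyaWalk` does not assume measurability of `X t`; it follows by gluing over the countably
many events "exactly `n` renewals by time `t`". -/
lemma aemeasurable (hγ : 0 < γ) (hN : 0 < N)
    (h : IsPolyaWalk (ehrenfestMatrix γ) ![γ * k₀, γ * (N - k₀)] P X) (t : ℝ≥0) :
    AEMeasurable (X t) P := by
  obtain ⟨T, I, hc, hX⟩ := h
  let S : ℕ → Set Ω := fun n =>
    {ω | polyaRenewalTime T n ω ≤ t ∧ (t : ℝ) < polyaRenewalTime T (n + 1) ω}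
  have hS (n) : MeasurableSet (S n) :=
    (measurableSet_le (hc.measurable_polyaRenewalTime n) measurable_const).inter
      (measurableSet_lt measurable_const (hc.measurable_polyaRenewalTime (n + 1)))
  have hU : (⋃ n, S n) =ᵐ[P] Set.univ := by
    rw [eventuallyEq_univ]
    filter_upwards [hc.ae_exists_polyaRenewalTime_le_lt hγ hN] with ω hω
    exact Set.mem_iUnion.mpr (hω t)
  rw [← Measure.restrict_univ (μ := P), ← Measure.restrict_congr_set hU, aemeasurable_iUnion_iff]
  intro n
  refine ⟨polyaPosition (ehrenfestMatrix γ) ![γ * k₀, γ * (N - k₀)] I n,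
    measurable_polyaPosition fun k _ => hc.measurable_type k, ?_⟩
  filter_upwards [ae_restrict_of_ae hX, ae_restrict_mem (hS n)] with ω h1 h2
  exact h1 n t h2.1 h2.2

/-- The contributions of the numbers of renewals form the exponential series of `μγNt`. The floor
only reads off the count, since `X t ω 0 / γ` is almost surely an integer. -/
lemma integral_eigenfunction (hγ : 0 < γ) (hN : 0 < N)
    (h : IsPolyaWalk (ehrenfestMatrix γ) ![γ * k₀, γ * (N - k₀)] P X) {f : ℤ → ℝ} {C μ : ℝ}
    (hC : ∀ k, ‖f k‖ ≤ C)
    (hf : ∀ k : ℤ, 0 ≤ k → k ≤ N → k * f (k - 1) + (N - k) * f (k + 1) = N * μ * f k)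
    (t : ℝ≥0) :
    ∫ ω, f ⌊X t ω 0 / γ⌋ ∂P = Real.exp (-(γ * N * (1 - μ) * t)) * f k₀ := by
  have hae := h.aemeasurable hγ hN t
  obtain ⟨T, I, hc, hX⟩ := h
  let S : ℕ → Set Ω := fun n =>
    {ω | polyaRenewalTime T n ω ≤ t ∧ (t : ℝ) < polyaRenewalTime T (n + 1) ω}
  have hS (n) : MeasurableSet (S n) :=
    (measurableSet_le (hc.measurable_polyaRenewalTime n) measurable_const).inter
      (measurableSet_lt measurable_const (hc.measurable_polyaRenewalTime (n + 1)))
  have hU : (⋃ n, S n) =ᵐ[P] Set.univ := by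
    rw [eventuallyEq_univ]
    filter_upwards [hc.ae_exists_polyaRenewalTime_le_lt hγ hN] with ω hω
    exact Set.mem_iUnion.mpr (hω t)
  have hpos := hc.ae_time_pos (lam := γ * N) (by positivity) sum_polyaPosition_ehrenfest
  -- Disjointness holds only almost everywhere: it needs nonnegative waiting times, so that renewal
  -- times are ordered.
  have hd : Pairwise (Function.onFun (AEDisjoint P) S) := by
    have key {a b : ℕ} (hab : a < b) : AEDisjoint P (S a) (S b) := by
      refine measure_mono_null ?_ (ae_iff.mp hpos)
      rintro ω ⟨h1, h2⟩ hp
      have : polyaRenewalTime T (a + 1) ω ≤ polyaRenewalTime T b ω :=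
        Finset.sum_le_sum_of_subset_of_nonneg (Finset.range_mono hab) fun k _ _ => (hp k).le
      exact absurd (h1.2.trans_le this) (not_lt.mpr h2.1)
    intro a b hab
    rcases lt_or_gt_of_ne hab with hab | hab
    · exact key hab
    · exact (key hab).symm
  have hfm : AEStronglyMeasurable (fun ω => f ⌊X t ω 0 / γ⌋) P :=
    ((measurable_of_countable f).comp_aemeasurable (Int.measurable_floor.comp_aemeasurable
      (((measurable_pi_apply 0).comp_aemeasurable hae).div_const γ))).aestronglyMeasurable
  have hfi : Integrable (fun ω => f ⌊X t ω 0 / γ⌋) P :=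
    Integrable.of_bound hfm C (ae_of_all _ fun _ => hC _)
  have hs := hasSum_integral_iUnion_ae (fun n => (hS n).nullMeasurableSet) hd hfi.integrableOn
  rw [Measure.restrict_congr_set hU, Measure.restrict_univ] at hs
  have hterm (n : ℕ) : ∫ ω in S n, f ⌊X t ω 0 / γ⌋ ∂P =
      Real.exp (-(γ * N * t)) * f k₀ * ((μ * (γ * N) * t) ^ n / n.factorial) := by
    refine Eq.trans ?_ (hc.setIntegral_ehrenfestCount hγ hN hC hf t.2 n)
    refine setIntegral_congr_ae (hS n) ?_
    filter_upwards [hX] with ω hω hmem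
    rw [hω n t hmem.1 hmem.2, polyaPosition_ehrenfest]
    simp [hγ.ne']
  simp only [hterm] at hs
  have hexp := (NormedSpace.expSeries_div_hasSum_exp (𝔸 := ℝ) (μ * (γ * N) * t)).mul_left
    (Real.exp (-(γ * N * t)) * f k₀)
  rw [hs.unique hexp, ← Real.exp_eq_exp_ℝ, mul_right_comm, ← Real.exp_add]
  ring_nf

end IsPolyaWalk

/-! ### Generating functions via the Krawtchouk expansion -/

/-- The Krawtchouk polynomial of degree `j` on `{0, …, N}`, extended by zero to all integers. -/
noncomputable def krawtchoukInt (N j : ℕ) (k : ℤ) : ℝ :=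
  if 0 ≤ k ∧ k ≤ N then krawtchouk N j k.toNat else 0

lemma krawtchoukInt_natCast {N j k : ℕ} (hk : k ≤ N) : krawtchoukInt N j k = krawtchouk N j k := by
  rw [krawtchoukInt, if_pos ⟨by omega, by omega⟩, Int.toNat_natCast]

lemma norm_krawtchoukInt_le (N j : ℕ) (k : ℤ) :
    ‖krawtchoukInt N j k‖ ≤ ∑ i ∈ Finset.range (N + 1), ‖krawtchouk N j i‖ := by
  unfold krawtchoukInt
  split_ifs with h
  · exact Finset.single_le_sum (f := fun i => ‖krawtchouk N j i‖) (fun i _ => norm_nonneg _)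
      (Finset.mem_range.mpr (by omega))
  · rw [norm_zero]
    exact Finset.sum_nonneg fun i _ => norm_nonneg _

lemma krawtchoukInt_eigenfunction {N : ℕ} (hN : 0 < N) (j : ℕ) (k : ℤ) (h0 : 0 ≤ k) (hk : k ≤ N) :
    k * krawtchoukInt N j (k - 1) + (N - k) * krawtchoukInt N j (k + 1) =
      N * (1 - 2 * j / N) * krawtchoukInt N j k := by
  obtain ⟨k, rfl⟩ := Int.eq_ofNat_of_zero_le h0
  have hkN : k ≤ N := by omega
  have h1 : (k : ℝ) * krawtchoukInt N j (k - 1) = k * krawtchouk N j (k - 1) := by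
    rcases k with _ | k
    · simp
    · rw [← krawtchoukInt_natCast (by omega)]; simp
  have h2 : ((N : ℝ) - k) * krawtchoukInt N j (k + 1) = (N - k) * krawtchouk N j (k + 1) := by
    rcases hkN.eq_or_lt with rfl | hlt
    · simp
    · rw [← krawtchoukInt_natCast (by omega)]; simp
  have hN' : (N : ℝ) * (1 - 2 * j / N) = N - 2 * j := by
    have : (N : ℝ) ≠ 0 := by positivity
    field_simp
  rw [hN', krawtchoukInt_natCast hkN, ← krawtchouk_recurrence hkN, ← h1, ← h2]
  simp

namespace IsPolyaWalk

variable {Ω : Type*} {γ : ℝ} {k₀ N : ℕ} {mΩ : MeasurableSpace Ω} {P : Measure Ω}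
  [IsProbabilityMeasure P] {X : ℝ≥0 → Ω → Fin 2 → ℝ}

/-- The probability generating function of the scaled walk, as if the particles switched urns
independently of each other. -/
lemma integral_pow_floor {𝕜 : Type*} [RCLike 𝕜] (hγ : 0 < γ) (hN : 0 < N) (hk : k₀ ≤ N)
    (h : IsPolyaWalk (ehrenfestMatrix γ) ![γ * k₀, γ * (N - k₀)] P X) (t : ℝ≥0) (z : 𝕜) :
    ∫ ω, z ^ ⌊X t ω 0 / γ⌋.toNat ∂P =
      ((1 + z) / 2 + (Real.exp (-2 * γ * t) : 𝕜) * ((z - 1) / 2)) ^ k₀ *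
        ((1 + z) / 2 - (Real.exp (-2 * γ * t) : 𝕜) * ((z - 1) / 2)) ^ (N - k₀) := by
  have hint (j : ℕ) : Integrable (fun ω => krawtchoukInt N j ⌊X t ω 0 / γ⌋) P :=
    Integrable.of_bound ((measurable_of_countable (krawtchoukInt N j)).comp_aemeasurable
      (Int.measurable_floor.comp_aemeasurable (((measurable_pi_apply 0).comp_aemeasurable
        (h.aemeasurable hγ hN t)).div_const γ))).aestronglyMeasurable _
      (ae_of_all _ fun _ => norm_krawtchoukInt_le N j _)
  -- The choice `α = (1 + z) / 2`, `β = (z - 1) / 2` solves `α + β = z`, `α - β = 1`, so the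
  -- Krawtchouk sum is exactly `z ^ k`.
  have h1 (ω : Ω) (k : ℕ) (hk : k ≤ N) (hX : X t ω = ![γ * k, γ * (N - k)]) :
      z ^ ⌊X t ω 0 / γ⌋.toNat = ∑ j ∈ Finset.range (N + 1),
        (krawtchoukInt N j ⌊X t ω 0 / γ⌋ : 𝕜) * (((z - 1) / 2) ^ j * ((1 + z) / 2) ^ (N - j)) := by
    have hfl : ⌊X t ω 0 / γ⌋ = k := by rw [hX]; simp [hγ.ne']
    simp only [hfl, Int.toNat_natCast, krawtchoukInt_natCast hk, ← mul_assoc]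
    rw [sum_krawtchouk_mul_pow _ _ hk,
      show (1 + z) / 2 + (z - 1) / 2 = z by ring, show (1 + z) / 2 - (z - 1) / 2 = 1 by ring]
    simp
  calc ∫ ω, z ^ ⌊X t ω 0 / γ⌋.toNat ∂P
      = ∫ ω, ∑ j ∈ Finset.range (N + 1), (krawtchoukInt N j ⌊X t ω 0 / γ⌋ : 𝕜) *
          (((z - 1) / 2) ^ j * ((1 + z) / 2) ^ (N - j)) ∂P := by
        refine integral_congr_ae ?_
        filter_upwards [h.ae_exists_eq hγ hN] with ω hω
        obtain ⟨k, hk, hX⟩ := hω t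
        exact h1 ω k hk hX
    _ = ∑ j ∈ Finset.range (N + 1), ((∫ ω, krawtchoukInt N j ⌊X t ω 0 / γ⌋ ∂P : ℝ) : 𝕜) *
          (((z - 1) / 2) ^ j * ((1 + z) / 2) ^ (N - j)) := by
        rw [integral_finsetSum _ fun j _ => (hint j).ofReal.mul_const _]
        refine Finset.sum_congr rfl fun j _ => ?_
        rw [integral_mul_const, integral_ofReal]
    _ = _ := by
        rw [← sum_krawtchouk_mul_pow _ _ hk]
        refine Finset.sum_congr rfl fun j _ => ?_
        rw [h.integral_eigenfunction hγ hN (norm_krawtchoukInt_le N j)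
          (krawtchoukInt_eigenfunction hN j), krawtchoukInt_natCast hk, mul_pow]
        -- Decay is geometric in the degree `j`, so it is absorbed by replacing `β` with `exp (-2γt)
        -- β` and the sum closes up again.
        have : Real.exp (-(γ * N * (1 - (1 - 2 * j / N)) * t)) = Real.exp (-2 * γ * t) ^ j := by
          rw [← Real.exp_nat_mul]
          congr 1
          have : (N : ℝ) ≠ 0 := by positivity
          field_simp
          ring
        rw [this]
        push_cast
        ring

lemma integrable_exp_mul (hγ : 0 < γ) (hN : 0 < N)
    (h : IsPolyaWalk (ehrenfestMatrix γ) ![γ * k₀, γ * (N - k₀)] P X) (t : ℝ≥0) (u : ℝ) :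
    Integrable (fun ω => Real.exp (u * X t ω 0)) P := by
  have hm : AEMeasurable (fun ω => X t ω 0) P :=
    (measurable_pi_apply 0).comp_aemeasurable (h.aemeasurable hγ hN t)
  refine Integrable.of_bound (Real.measurable_exp.comp_aemeasurable
    (hm.const_mul u)).aestronglyMeasurable (Real.exp (|u| * (γ * N))) ?_
  filter_upwards [h.ae_exists_eq hγ hN] with ω hω
  obtain ⟨k, hk, hX⟩ := hω t
  rw [Real.norm_of_nonneg (Real.exp_pos _).le, Real.exp_le_exp, hX]
  have hk' : (k : ℝ) ≤ N := by exact_mod_cast hk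
  calc u * (γ * k) ≤ |u| * (γ * k) := by gcongr; exact le_abs_self u
    _ ≤ |u| * (γ * N) := by gcongr

lemma mgf_eq (hγ : 0 < γ) (hN : 0 < N) (hk : k₀ ≤ N)
    (h : IsPolyaWalk (ehrenfestMatrix γ) ![γ * k₀, γ * (N - k₀)] P X) (t : ℝ≥0) (u : ℝ) :
    mgf (fun ω => X t ω 0) P u =
      ((1 + Real.exp (γ * u)) / 2 + Real.exp (-2 * γ * t) * ((Real.exp (γ * u) - 1) / 2)) ^ k₀ *
        ((1 + Real.exp (γ * u)) / 2 -
          Real.exp (-2 * γ * t) * ((Real.exp (γ * u) - 1) / 2)) ^ (N - k₀) := by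
  refine Eq.trans ?_ (h.integral_pow_floor (𝕜 := ℝ) hγ hN hk t (Real.exp (γ * u)))
  refine integral_congr_ae ?_
  filter_upwards [h.ae_exists_eq hγ hN] with ω hω
  obtain ⟨k, hk, hX⟩ := hω t
  rw [hX, ← Real.exp_nat_mul]
  simp only [Matrix.cons_val_zero, mul_div_cancel_left₀ _ hγ.ne', Int.floor_natCast,
    Int.toNat_natCast]
  ring_nf

lemma charFun_eq (hγ : 0 < γ) (hN : 0 < N) (hk : k₀ ≤ N)
    (h : IsPolyaWalk (ehrenfestMatrix γ) ![γ * k₀, γ * (N - k₀)] P X) (t : ℝ≥0) (s : ℝ) :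
    charFun (P.map fun ω => X t ω 0 / γ) s =
      ((1 + Complex.exp (s * Complex.I)) / 2 + (Real.exp (-2 * γ * t) : ℂ) *
        ((Complex.exp (s * Complex.I) - 1) / 2)) ^ k₀ *
      ((1 + Complex.exp (s * Complex.I)) / 2 - (Real.exp (-2 * γ * t) : ℂ) *
        ((Complex.exp (s * Complex.I) - 1) / 2)) ^ (N - k₀) := by
  have hm : AEMeasurable (fun ω => X t ω 0 / γ) P :=
    ((measurable_pi_apply 0).comp_aemeasurable (h.aemeasurable hγ hN t)).div_const γ
  refine Eq.trans ?_ (h.integral_pow_floor (𝕜 := ℂ) hγ hN hk t (Complex.exp (s * Complex.I)))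
  rw [charFun_apply_real, integral_map hm (by fun_prop)]
  refine integral_congr_ae ?_
  filter_upwards [h.ae_exists_eq hγ hN] with ω hω
  obtain ⟨k, hk, hX⟩ := hω t
  rw [hX, ← Complex.exp_nat_mul]
  simp only [Matrix.cons_val_zero, mul_div_cancel_left₀ _ hγ.ne', Int.floor_natCast,
    Int.toNat_natCast]
  push_cast
  ring_nf

end IsPolyaWalk

/-! ### Limit law and the main theorem -/

lemma charFun_map_cast_binomial (N : ℕ) (p : unitInterval) (s : ℝ) :
    charFun ((binomial N p).map (fun k : ℕ => (k : ℝ))) s =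
      (1 - (p : ℝ) + (p : ℝ) * Complex.exp (s * Complex.I)) ^ N := by
  rw [charFun_apply_real, integral_map (by fun_prop) (by fun_prop), integral_binomial, add_comm,
    add_pow, ← Nat.range_succ_eq_Iic]
  refine Finset.sum_congr rfl fun k _ => ?_
  rw [mul_pow, ← Complex.exp_nat_mul, Complex.real_smul]
  push_cast
  ring_nf

lemma tendsto_exp_neg_two_mul {γ : ℝ} (hγ : 0 < γ) :
    Tendsto (fun t : ℝ≥0 => Real.exp (-2 * γ * t)) atTop (𝓝 0) := by
  refine Real.tendsto_exp_atBot.comp ?_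
  exact NNReal.tendsto_coe_atTop.mpr tendsto_id |>.const_mul_atTop_of_neg (by linarith)

lemma IsPolyaWalk.tendstoInDistribution {Ω : Type*} {γ : ℝ} {k₀ N : ℕ} {mΩ : MeasurableSpace Ω}
    {P : Measure Ω} [IsProbabilityMeasure P] {X : ℝ≥0 → Ω → Fin 2 → ℝ} (hγ : 0 < γ) (hN : 0 < N)
    (hk : k₀ ≤ N) (h : IsPolyaWalk (ehrenfestMatrix γ) ![γ * k₀, γ * (N - k₀)] P X) :
    TendstoInDistribution (fun (t : ℝ≥0) ω => X t ω 0 / γ) atTop (fun k : ℕ => (k : ℝ))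
      (fun _ => P) (binomial N ⟨1 / 2, by norm_num, by norm_num⟩) where
  forall_aemeasurable t :=
    ((measurable_pi_apply 0).comp_aemeasurable (h.aemeasurable hγ hN t)).div_const γ
  tendsto := by
    refine tendsto_of_seq_tendsto fun t ht => ?_
    refine ProbabilityMeasure.tendsto_iff_tendsto_charFun.mpr fun s => ?_
    refine Tendsto.congr (fun n => (h.charFun_eq hγ hN hk (t n) s).symm) ?_
    rw [ProbabilityMeasure.coe_mk, charFun_map_cast_binomial]
    have hq : Tendsto (fun n => (Real.exp (-2 * γ * t n) : ℂ)) atTop (𝓝 0) := by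
      exact_mod_cast (Complex.continuous_ofReal.tendsto 0).comp
        ((tendsto_exp_neg_two_mul hγ).comp ht)
    set z := Complex.exp (s * Complex.I)
    have hq' := hq.mul_const ((z - 1) / 2)
    have := ((tendsto_const_nhds (x := (1 + z) / 2)).add hq').pow k₀ |>.mul
      (((tendsto_const_nhds (x := (1 + z) / 2)).sub hq').pow (N - k₀))
    simp only [zero_mul, add_zero, sub_zero, ← pow_add, Nat.add_sub_cancel' hk] at this
    convert! this using 3
    simp only [Complex.ofReal_div, Complex.ofReal_one, Complex.ofReal_ofNat]
    ring

theorem mainTheorem5 (γ : ℝ) (hγ : 0 < γ) (lam x₀ y₀ : ℝ) (hlam : x₀ + y₀ = lam) :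
    (PolyaTenable (ehrenfestMatrix γ) ![x₀, y₀] ↔
      (∃ k : ℕ, x₀ / γ = k) ∧ (∃ m : ℕ, y₀ / γ = m) ∧ 0 < lam) ∧
    (PolyaTenable (ehrenfestMatrix γ) ![x₀, y₀] →
      ∃ N : ℕ, 0 < N ∧ lam / γ = N ∧
        ∀ {Ω : Type*} [MeasurableSpace Ω] (P : Measure Ω) [IsProbabilityMeasure P]
          (X : ℝ≥0 → Ω → Fin 2 → ℝ),
          IsPolyaWalk (ehrenfestMatrix γ) ![x₀, y₀] P X →
          (∀ᵐ ω ∂P, ∀ t : ℝ≥0, X t ω 0 + X t ω 1 = lam) ∧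
          (∀ (t : ℝ≥0) (u : ℝ),
            Integrable (fun ω => Real.exp (u * X t ω 0)) P ∧
            mgf (fun ω => X t ω 0) P u =
              ((1 + Real.exp (-2 * γ * t + γ * u) + Real.exp (γ * u) - Real.exp (-2 * γ * t)) /
                (1 - Real.exp (-2 * γ * t + γ * u) + Real.exp (γ * u) + Real.exp (-2 * γ * t)))
                  ^ (x₀ / γ) *
              ((1 - Real.exp (-2 * γ * t + γ * u) + Real.exp (γ * u) + Real.exp (-2 * γ * t)) / 2)
                  ^ (lam / γ)) ∧
          (∀ u : ℝ, Tendsto (fun t : ℝ≥0 => mgf (fun ω => X t ω 0) P u) atTop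
            (𝓝 (((1 + Real.exp (γ * u)) / 2) ^ (lam / γ)))) ∧
          TendstoInDistribution (fun (t : ℝ≥0) ω => X t ω 0 / γ) atTop (fun k : ℕ => (k : ℝ))
            (fun _ => P) (binomial N ⟨1 / 2, by norm_num, by norm_num⟩)) := by
  refine ⟨polyaTenable_ehrenfest_iff hγ hlam, fun hten => ?_⟩
  obtain ⟨⟨k, hxk⟩, ⟨m, hym⟩, hpos⟩ := (polyaTenable_ehrenfest_iff hγ hlam).mp hten
  have hlamN : lam / γ = (k + m : ℕ) := by
    rw [← hlam, add_div, hxk, hym, Nat.cast_add]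
  have hN : 0 < k + m := by
    have : 0 < lam / γ := div_pos hpos hγ
    rw [hlamN] at this
    exact_mod_cast this
  have hx : x₀ = γ * k := by rw [← hxk]; field_simp
  have hy : y₀ = γ * ((k + m : ℕ) - k) := by push_cast; rw [← hym]; field_simp; ring
  refine ⟨k + m, hN, hlamN, fun {Ω} _ P _ X hX => ?_⟩
  rw [hx, hy] at hX
  refine ⟨?_, fun t u => ⟨hX.integrable_exp_mul hγ hN t u, ?_⟩, fun u => ?_,
    hX.tendstoInDistribution hγ hN (by omega)⟩
  · filter_upwards [hX.ae_exists_eq hγ hN] with ω hω t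
    obtain ⟨j, _, hj⟩ := hω t
    rw [hj, ← hlam, hx, hy]
    simp
    ring
  · rw [hX.mgf_eq hγ hN (by omega), hxk, hlamN, Real.rpow_natCast, Real.rpow_natCast,
      Nat.add_sub_cancel_left, Real.exp_add]
    have hq1 : Real.exp (-2 * γ * t) ≤ 1 := by
      rw [Real.exp_le_one_iff]
      have := mul_nonneg hγ.le t.2
      nlinarith
    have hq0 := Real.exp_pos (-2 * γ * t)
    have hz := Real.exp_pos (γ * u)
    set q := Real.exp (-2 * γ * t)
    set z := Real.exp (γ * u)
    -- The denominator equals `1 + q + z (1 - q)`, positive because `0 < q ≤ 1`; its `k`-th power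
    -- then cancels against the second factor.
    have hD : 1 - q * z + z + q ≠ 0 := by nlinarith
    rw [pow_add, div_pow, ← mul_assoc, div_pow (1 - q * z + z + q) 2 k, div_mul_div_comm,
      mul_comm ((1 - q * z + z + q) ^ k), mul_div_mul_right _ _ (pow_ne_zero k hD), ← div_pow]
    ring
  · simp only [hX.mgf_eq hγ hN (Nat.le_add_right k m), hlamN, Real.rpow_natCast]
    have hq := (tendsto_exp_neg_two_mul hγ).mul_const ((Real.exp (γ * u) - 1) / 2)
    have := ((tendsto_const_nhds (x := (1 + Real.exp (γ * u)) / 2)).add hq).pow k |>.mul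
      (((tendsto_const_nhds (x := (1 + Real.exp (γ * u)) / 2)).sub hq).pow (k + m - k))
    simpa only [zero_mul, add_zero, sub_zero, ← pow_add, Nat.add_sub_cancel' (Nat.le_add_right k m)]
      using this
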